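/- Let $\mathcal X,\mathcal Y$ be finite alphabets and let $P_X,P_Y$ be probability distributions on $\mathcal X$ and $\mathcal Y$. All logarithms are natural. For distributions $P,Q$ on finite sets $\mathcal A,\mathcal B$ let $C(P,Q)$ be the set of couplings (joint distributions on $\mathcal A\times\mathcal B$ with marginals $P$ and $Q$), and let $$\mathcal G(P,Q):=\max_{P_{AB}\in C(P,Q)}\ \max_{f:\mathcal A\to\mathcal B}\mathbb P\{B=f(A)\}$$ be the maximal guessing probability. Let $P_X^n,P_Y^n$ be the $n$-fold product distributions on $\mathcal X^n,\mathcal Y^n$, and define in $[0,\infty]$ (with $\log 0=-\infty$) $$\overline{\mathsf E}(P_X,P_Y):=\liminf_{n\to\infty}-\tfrac1n\log\bigl(1-\mathcal G(P_X^n,P_Y^n)\bigr),\qquad \mathsf E(P_X,P_Y):=\liminf_{n\to\infty}-\tfrac1n\log\mathcal G(P_X^n,P_Y^n).$$ Let $H$ denote the Shannon entropy and, for $\alpha\ge 0$, $\alpha\neq1$, let $H_\alpha(X):=\frac1{1-\alpha}\log\sum_{x:P_X(x)>0}P_X(x)^\alpha$ be the Rényi entropy of order $\alpha$, with $H_1:=H$;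 similarly for $Y$. Put $\delta_\epsilon(P):=\frac13\epsilon^2\min_{x:P(x)>0}P(x)$. A sequence $a_n\ge 0$ is said to tend to $0$ at least exponentially fast if $a_n\le Ce^{-cn}$ for all $n$ and some $c,C>0$, and exponentially fast if moreover $a_n\ge C'e^{-c'n}$ for all $n$ and some $c',C'>0$. Then: 1. If $H(X)>H(Y)$, then $\mathcal G(P_X^n,P_Y^n)\to1$ at least exponentially fast (that is, $1-\mathcal G(P_X^n,P_Y^n)\to 0$ at least exponentially fast) as $n\to\infty$. Moreover, $$\overline{\mathsf E}(P_X,P_Y)\ \ge\ \frac12\max_{t\in[0,1]}t\bigl(H_{1+t}(X)-H_{1-t}(Y)\bigr),$$ the maximum being attained. 2. If $H(X)<H(Y)$, then $\mathcal G(P_X^n,P_Y^n)\to0$ exponentially fast as $n\to\infty$. Moreover, $$\log|\mathcal Y|\ \ge\ \mathsf E(P_X,P_Y)\ \ge\ \sup_{\epsilon\in(0,1)}\min\bigl\{\delta_\epsilon(P_X),\ \delta_\epsilon(P_Y),\ (1-\epsilon)H(Y)-(1+\epsilon)H(X)\bigr\}.$$ 3. If $H(X)=H(Y)$, then $\mathcal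 G(P_X^n,P_Y^n)\ge\mathcal G(P_X,P_Y)^n$ for all $n$. -/

import Mathlib

open Filter Topology

noncomputable section

namespace GuessingCoupling

/-! Probability distributions on a finite alphabet `X` are the elements of `stdSimplex ℝ X`.
All logarithms are natural. -/

/-- The set `C(P, Q)` of couplings of `P` and `Q`. -/
def couplings {X Y : Type*} [Fintype X] [Fintype Y] (P : X → ℝ) (Q : Y → ℝ) : Set (X × Y → ℝ) :=
  {R | R ∈ stdSimplex ℝ (X × Y) ∧ (∀ x, ∑ y, R (x, y) = P x) ∧ (∀ y, ∑ x, R (x, y) = Q y)}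

/-- The probability of the event `Y = f(X)` when `(X, Y)` has law `R`. -/
def hitProb {X Y : Type*} [Fintype X] (R : X × Y → ℝ) (f : X → Y) : ℝ :=
  ∑ x, R (x, f x)

/-- The maximal guessing probability `G(P, Q)`: the maximum of `ℙ{Y = f(X)}` over all couplings
of `P, Q` and all functions `f` (see `isGreatest_maxGuessProb` for attainment). -/
def maxGuessProb {X Y : Type*} [Fintype X] [Fintype Y] (P : X → ℝ) (Q : Y → ℝ) : ℝ :=
  sSup {p | ∃ R ∈ couplings P Q, ∃ f : X → Y, p = hitProb R f}

/-- The supremum in the definition of `maxGuessProb` is a maximum. -/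
theorem isGreatest_maxGuessProb {X Y : Type*} [Fintype X] [Fintype Y] {P : X → ℝ} {Q : Y → ℝ}
    (hP : P ∈ stdSimplex ℝ X) (hQ : Q ∈ stdSimplex ℝ Y) :
    IsGreatest {p | ∃ R ∈ couplings P Q, ∃ f : X → Y, p = hitProb R f} (maxGuessProb P Q) := by
  have hcomp : IsCompact (couplings P Q) := by
    refine (isCompact_stdSimplex ℝ (X × Y)).inter_right
      (t := {R | (∀ x, ∑ y, R (x, y) = P x) ∧ (∀ y, ∑ x, R (x, y) = Q y)}) ?_
    have h1 : IsClosed {R : X × Y → ℝ | ∀ x, ∑ y, R (x, y) = P x} := by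
      simp only [Set.ofPred_forall]
      exact isClosed_iInter fun x => isClosed_eq (by fun_prop) continuous_const
    have h2 : IsClosed {R : X × Y → ℝ | ∀ y, ∑ x, R (x, y) = Q y} := by
      simp only [Set.ofPred_forall]
      exact isClosed_iInter fun x => isClosed_eq (by fun_prop) continuous_const
    exact h1.inter h2
  have hset : {p | ∃ R ∈ couplings P Q, ∃ f : X → Y, p = hitProb R f}
      = ⋃ f : X → Y, (fun R => hitProb R f) '' couplings P Q := by
    ext p
    simp only [Set.mem_ofPred_eq, Set.mem_iUnion, Set.mem_image]
    constructor
    · rintro ⟨R, hR, f, rfl⟩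
      exact ⟨f, R, hR, rfl⟩
    · rintro ⟨f, R, hR, rfl⟩
      exact ⟨R, hR, f, rfl⟩
  have hc : IsCompact {p | ∃ R ∈ couplings P Q, ∃ f : X → Y, p = hitProb R f} := by
    rw [hset]
    exact isCompact_iUnion fun f => hcomp.image (by unfold hitProb; fun_prop)
  refine hc.isGreatest_sSup ?_
  have hne : Nonempty Y := by
    by_contra h
    rw [not_nonempty_iff] at h
    simpa using hQ.2
  refine ⟨_, fun z => P z.1 * Q z.2, ⟨⟨fun z => mul_nonneg (hP.1 _) (hQ.1 _), ?_⟩, ?_, ?_⟩,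
    fun _ => hne.some, rfl⟩
  · rw [Fintype.sum_prod_type]
    simp only [← Finset.mul_sum, hQ.2, mul_one, hP.2]
  · intro x
    simp only [← Finset.mul_sum, hQ.2, mul_one]
  · intro y
    simp only [← Finset.sum_mul, hP.2, one_mul]

/-- The product distribution `Pⁿ` on `Xⁿ`. -/
def prodDist {X : Type*} (P : X → ℝ) (n : ℕ) : (Fin n → X) → ℝ :=
  fun x => ∏ i, P (x i)

/-- Shannon entropy `-∑ₓ P(x) log P(x)`, with `0 log 0 = 0`. -/
def shannonEntropy {X : Type*} [Fintype X] (P : X → ℝ) : ℝ :=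
  ∑ x, Real.negMulLog (P x)

/-- Rényi entropy of finite order `α ≥ 0`: `(1 - α)⁻¹ log ∑_{x : P(x) > 0} P(x)^α` for `α ≠ 1`, and
the Shannon entropy for `α = 1`. In particular order `0` gives the log of the support size. -/
def renyiEntropy {X : Type*} [Fintype X] (α : ℝ) (P : X → ℝ) : ℝ :=
  if α = 1 then shannonEntropy P
  else (1 - α)⁻¹ * Real.log (∑ x with 0 < P x, P x ^ α)

/-- The exponent `liminf_{n → ∞} -(1/n) log aₙ ∈ [-∞, ∞]` of a nonnegative sequence, where
`log 0 = -∞`. -/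
def expRate (a : ℕ → ℝ) : EReal :=
  liminf (fun n : ℕ => -(ENNReal.log (ENNReal.ofReal (a n)) / (n : EReal))) atTop

/-- `aₙ → 0` at least exponentially fast. -/
def AtLeastExpFast (a : ℕ → ℝ) : Prop :=
  ∃ c > 0, ∃ C > 0, ∀ n : ℕ, |a n| ≤ C * Real.exp (-c * n)

/-- `aₙ → 0` exponentially fast: at least, and not more than, exponentially fast. -/
def ExpFast (a : ℕ → ℝ) : Prop :=
  AtLeastExpFast a ∧ ∃ c > 0, ∃ C > 0, ∀ n : ℕ, C * Real.exp (-c * n) ≤ |a n|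

/-- `δ_ε(P) = (1/3) ε² min_{x : P(x) > 0} P(x)`. The infimum is over a finite set, nonempty when
`P` is a distribution. -/
def typDelta {X : Type*} (ε : ℝ) (P : X → ℝ) : ℝ :=
  1 / 3 * ε ^ 2 * sInf (P '' {x | 0 < P x})

end GuessingCoupling

end

/-!
For fixed `f`, the best coupling makes `Y = f(X)` with probability `∑ y, min (P (f⁻¹ y)) (Q y)`
(only the lower bound `sum_min_le_maxGuessProb` is needed), so `1 - G(P, Q)` is at most the total
variation distance between `Q` and the image of `P` under `f`.

When `H(X) > H(Y)`, a map `f` with independent values drawn from `Q` makes this distance small. The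
choice is derandomised in `exists_weighted_sum_sq_le`. Masses with `P x ≤ Q y` are controlled by a
second moment and the others by their total mass; both are interpolated through
`K = (∑ P ^ (1 + t)) (∑ Q ^ (1 - t))`, which gives `1 - G(P, Q) ≤ √K + K`
(`one_sub_maxGuessProb_le`). The number `K` is multiplicative over product distributions and equals
`exp (-t (H_{1+t}(X) - H_{1-t}(Y)))`, whose exponent has slope `H(X) - H(Y) > 0` at `t = 0`
(`exists_renyi_pos`). This yields both the exponential convergence and the bound on the exponent.

When `H(X) < H(Y)`, Chernoff bounds on the number of occurrences of each letter show that `Xⁿ` is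
concentrated on at most `exp (n (1 + ε) H(X))` words (`exists_typical_small`), while `Yⁿ` is
concentrated on words of probability at most `exp (-n (1 - ε) H(Y))` (`exists_typical_light`). A
successful guess between the two sets has probability at most the product of these numbers, whatever
the coupling (`maxGuessProb_le_of_sets`).

Finally, products of couplings give `G(Pⁿ, Qⁿ) ≥ G(P, Q)ⁿ` (`pow_maxGuessProb_le`); combined with
`G(P, Q) ≥ 1 / |Y|`, this shows that the decay is never faster than exponential.
-/

namespace GuessingCoupling

/-! ### One-shot bounds on the guessing probability -/

section OneShot

variable {X Y : Type*} [Fintype X] [Fintype Y] {P : X → ℝ} {Q : Y → ℝ}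

theorem hitProb_le_maxGuessProb (hP : P ∈ stdSimplex ℝ X) (hQ : Q ∈ stdSimplex ℝ Y)
    {R : X × Y → ℝ} (hR : R ∈ couplings P Q) (f : X → Y) : hitProb R f ≤ maxGuessProb P Q :=
  (isGreatest_maxGuessProb hP hQ).2 ⟨R, hR, f, rfl⟩

theorem maxGuessProb_le (hP : P ∈ stdSimplex ℝ X) (hQ : Q ∈ stdSimplex ℝ Y) {c : ℝ}
    (h : ∀ R ∈ couplings P Q, ∀ f : X → Y, hitProb R f ≤ c) : maxGuessProb P Q ≤ c := by
  obtain ⟨R, hR, f, hf⟩ := (isGreatest_maxGuessProb hP hQ).1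
  exact hf ▸ h R hR f

theorem couplings_le_left {R : X × Y → ℝ} (hR : R ∈ couplings P Q) (x : X) (y : Y) :
    R (x, y) ≤ P x :=
  hR.2.1 x ▸ Finset.single_le_sum (f := fun y => R (x, y)) (fun _ _ => hR.1.1 _)
    (Finset.mem_univ y)

theorem couplings_le_right {R : X × Y → ℝ} (hR : R ∈ couplings P Q) (x : X) (y : Y) :
    R (x, y) ≤ Q y :=
  hR.2.2 y ▸ Finset.single_le_sum (f := fun x => R (x, y)) (fun _ _ => hR.1.1 _)
    (Finset.mem_univ x)

theorem maxGuessProb_le_one (hP : P ∈ stdSimplex ℝ X) (hQ : Q ∈ stdSimplex ℝ Y) :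
    maxGuessProb P Q ≤ 1 :=
  maxGuessProb_le hP hQ fun _ hR f =>
    hP.2 ▸ Finset.sum_le_sum fun x _ => couplings_le_left hR x (f x)

theorem maxGuessProb_nonneg (hP : P ∈ stdSimplex ℝ X) (hQ : Q ∈ stdSimplex ℝ Y) :
    0 ≤ maxGuessProb P Q := by
  obtain ⟨R, hR, f, hf⟩ := (isGreatest_maxGuessProb hP hQ).1
  exact hf ▸ Finset.sum_nonneg fun x _ => hR.1.1 _

/-- A mass `r ≤ P` whose image under `f` is dominated by `Q` can be carried by the graph of `f`
inside a coupling of `P` and `Q`: the remaining masses are coupled independently. -/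
theorem sum_le_maxGuessProb [DecidableEq Y] (hP : P ∈ stdSimplex ℝ X) (hQ : Q ∈ stdSimplex ℝ Y)
    (f : X → Y) {r : X → ℝ} (hr0 : ∀ x, 0 ≤ r x) (hrP : ∀ x, r x ≤ P x)
    (hrQ : ∀ y, ∑ x with f x = y, r x ≤ Q y) : ∑ x, r x ≤ maxGuessProb P Q := by
  set m : Y → ℝ := fun y => ∑ x with f x = y, r x with hm
  set D : ℝ := 1 - ∑ x, r x with hD
  have hmr : ∑ y, m y = ∑ x, r x := Finset.sum_fiberwise _ _ _
  have hα : ∑ x, (P x - r x) = D := by rw [Finset.sum_sub_distrib, hP.2]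
  have hβ : ∑ y, (Q y - m y) = D := by rw [Finset.sum_sub_distrib, hQ.2, hmr]
  have hα0 : ∀ x, 0 ≤ P x - r x := fun x => sub_nonneg.2 (hrP x)
  have hβ0 : ∀ y, 0 ≤ Q y - m y := fun y => sub_nonneg.2 (hrQ y)
  have hD0 : 0 ≤ D := hα ▸ Finset.sum_nonneg fun x _ => hα0 x
  -- When `D = 0` both residual masses vanish, so division by `D` is harmless.
  have hαD : ∀ x, (P x - r x) * D / D = P x - r x := by
    intro x
    rcases eq_or_ne D 0 with h | h
    · have := (Finset.sum_eq_zero_iff_of_nonneg fun x _ => hα0 x).1 (hα.trans h) x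
        (Finset.mem_univ x)
      simp [this]
    · field_simp
  have hβD : ∀ y, D * (Q y - m y) / D = Q y - m y := by
    intro y
    rcases eq_or_ne D 0 with h | h
    · have := (Finset.sum_eq_zero_iff_of_nonneg fun y _ => hβ0 y).1 (hβ.trans h) y
        (Finset.mem_univ y)
      simp [this]
    · field_simp
  set R : X × Y → ℝ := fun z => (if f z.1 = z.2 then r z.1 else 0)
    + (P z.1 - r z.1) * (Q z.2 - m z.2) / D with hR
  have hR0 : ∀ z, 0 ≤ R z := by
    intro z
    refine add_nonneg ?_ (div_nonneg (mul_nonneg (hα0 _) (hβ0 _)) hD0)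
    split_ifs
    exacts [hr0 _, le_rfl]
  have hRx : ∀ x, ∑ y, R (x, y) = P x := by
    intro x
    simp only [hR]
    rw [Finset.sum_add_distrib, ← Finset.sum_div, ← Finset.mul_sum, hβ, hαD]
    simp
  have hRy : ∀ y, ∑ x, R (x, y) = Q y := by
    intro y
    simp only [hR]
    rw [Finset.sum_add_distrib, ← Finset.sum_div, ← Finset.sum_mul, hα, hβD,
      ← Finset.sum_filter]
    simp [hm]
  have hmem : R ∈ couplings P Q :=
    ⟨⟨hR0, by rw [Fintype.sum_prod_type]; simp only [hRx, hP.2]⟩, hRx, hRy⟩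
  refine le_trans (Finset.sum_le_sum fun x _ => ?_) (hitProb_le_maxGuessProb hP hQ hmem f)
  simp only [hR, if_true]
  exact le_add_of_nonneg_right (div_nonneg (mul_nonneg (hα0 _) (hβ0 _)) hD0)

/-- The overlap of `Q` with the image of `P` under any `f` bounds the guessing probability from
below. -/
theorem sum_min_le_maxGuessProb [DecidableEq Y] (hP : P ∈ stdSimplex ℝ X)
    (hQ : Q ∈ stdSimplex ℝ Y) (f : X → Y) :
    ∑ y, min (∑ x with f x = y, P x) (Q y) ≤ maxGuessProb P Q := by
  set p : Y → ℝ := fun y => ∑ x with f x = y, P x with hp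
  have hp0 : ∀ y, 0 ≤ p y := fun y => Finset.sum_nonneg fun x _ => hP.1 x
  have hm0 : ∀ y, 0 ≤ min (p y) (Q y) := fun y => le_min (hp0 y) (hQ.1 y)
  have hfib : ∀ y, ∑ x with f x = y, P x * (min (p (f x)) (Q (f x)) / p (f x))
      = min (p y) (Q y) := by
    intro y
    have : ∑ x with f x = y, P x * (min (p (f x)) (Q (f x)) / p (f x))
        = ∑ x with f x = y, P x * (min (p y) (Q y) / p y) :=
      Finset.sum_congr rfl fun x hx => by rw [(Finset.mem_filter.1 hx).2]
    rw [this, ← Finset.sum_mul]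
    change p y * _ = _
    rcases eq_or_ne (p y) 0 with h | h
    · simp [h, hQ.1 y]
    · field_simp
  rw [← Finset.sum_congr rfl fun y _ => hfib y, Finset.sum_fiberwise]
  refine sum_le_maxGuessProb hP hQ f (fun x => mul_nonneg (hP.1 x) (div_nonneg (hm0 _) (hp0 _)))
    (fun x => mul_le_of_le_one_right (hP.1 x)
      (div_le_one_of_le₀ (min_le_left _ _) (hp0 _))) fun y => ?_
  rw [hfib]
  exact min_le_right _ _

/-- A function takes a value at most its mean. -/
theorem exists_le_of_sum_mul_le (hQ : Q ∈ stdSimplex ℝ Y) {F : Y → ℝ} {K : ℝ}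
    (h : ∑ z, Q z * F z ≤ K) : ∃ z, F z ≤ K := by
  by_contra! hlt
  have h0 : ∀ z, 0 ≤ Q z * (F z - K) := fun z =>
    mul_nonneg (hQ.1 z) (sub_nonneg.2 (hlt z).le)
  have hsum : ∑ z, Q z * (F z - K) = 0 := by
    refine le_antisymm ?_ (Finset.sum_nonneg fun z _ => h0 z)
    simp only [mul_sub, Finset.sum_sub_distrib, ← Finset.sum_mul, hQ.2]
    linarith
  have hz := (Finset.sum_eq_zero_iff_of_nonneg fun z _ => h0 z).1 hsum
  have : ∑ z, Q z = 0 := Finset.sum_eq_zero fun z hz' =>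
    (mul_eq_zero.1 (hz z hz')).resolve_right (sub_pos.2 (hlt z)).ne'
  rw [hQ.2] at this
  exact one_ne_zero this

/-- If the values `f x` were drawn independently from `Q`, the expectation of the left-hand side
would be at most the right-hand side. The map `f` is obtained by choosing its values one at a time
so that the conditional expectation does not increase. -/
theorem exists_weighted_sum_sq_le {X : Type*} [DecidableEq Y] (hQ : Q ∈ stdSimplex ℝ Y) {w : Y → ℝ}
    (hw : ∀ y, 0 ≤ w y) (c : X → Y → ℝ) (s : Finset X) (a : Y → ℝ) :
    ∃ f : X → Y, ∑ y, w y * (a y + ∑ x ∈ s, c x y * ((if f x = y then 1 else 0) - Q y)) ^ 2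
      ≤ ∑ y, w y * a y ^ 2 + ∑ x ∈ s, ∑ y, w y * (c x y ^ 2 * Q y) := by
  classical
  have hne : Nonempty Y := by
    by_contra h
    rw [not_nonempty_iff] at h
    simpa using hQ.2
  induction s using Finset.induction_on generalizing a with
  | empty => exact ⟨fun _ => hne.some, by simp⟩
  | insert x₀ s hx₀ ih =>
    have havg : ∑ z, Q z * ∑ y, w y * (a y + c x₀ y * ((if z = y then 1 else 0) - Q y)) ^ 2
        ≤ ∑ y, w y * a y ^ 2 + ∑ y, w y * (c x₀ y ^ 2 * Q y) := by
      simp only [Finset.mul_sum]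
      rw [Finset.sum_comm, ← Finset.sum_add_distrib]
      refine Finset.sum_le_sum fun y _ => ?_
      have hz : ∀ z, Q z * (w y * (a y + c x₀ y * ((if z = y then 1 else 0) - Q y)) ^ 2)
          = Q z * (w y * (a y - c x₀ y * Q y) ^ 2)
            + if z = y then Q z * (w y * (2 * (a y - c x₀ y * Q y) * c x₀ y + c x₀ y ^ 2))
              else 0 := by
        intro z
        split_ifs <;> ring
      simp only [hz, Finset.sum_add_distrib, ← Finset.sum_mul, hQ.2, Finset.sum_ite_eq',
        Finset.mem_univ, if_true]
      nlinarith [mul_nonneg (hw y) (sq_nonneg (c x₀ y * Q y))]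
    obtain ⟨z, hz⟩ := exists_le_of_sum_mul_le hQ havg
    obtain ⟨f, hf⟩ := ih fun y => a y + c x₀ y * ((if z = y then 1 else 0) - Q y)
    refine ⟨Function.update f x₀ z, ?_⟩
    have hupd : ∀ y, ∑ x ∈ insert x₀ s,
          c x y * ((if Function.update f x₀ z x = y then 1 else 0) - Q y)
        = c x₀ y * ((if z = y then 1 else 0) - Q y)
          + ∑ x ∈ s, c x y * ((if f x = y then 1 else 0) - Q y) := by
      intro y
      rw [Finset.sum_insert hx₀, Function.update_self]
      congr 1
      refine Finset.sum_congr rfl fun x hx => ?_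
      rw [Function.update_of_ne (ne_of_mem_of_not_mem hx hx₀)]
    simp only [hupd, ← add_assoc]
    rw [Finset.sum_insert hx₀]
    linarith

/-- The power sum `∑ P(x) ^ s` over the support of `P`. -/
noncomputable def powerSum (s : ℝ) (P : X → ℝ) : ℝ :=
  ∑ x with 0 < P x, P x ^ s

theorem powerSum_eq_sum_ite (s : ℝ) (P : X → ℝ) :
    powerSum s P = ∑ x, if 0 < P x then P x ^ s else 0 :=
  Finset.sum_filter _ _

/-- One-shot achievability. With `f` as in `exists_weighted_sum_sq_le`, the image of `P` is compared
with `Q` at `y` through the masses `P x ≤ Q y` only. Their fluctuation around the mean is controlled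
by a second moment, which gives the square root, and the masses `P x > Q y` that are left out give
the other term. -/
theorem one_sub_maxGuessProb_le (hP : P ∈ stdSimplex ℝ X) (hQ : Q ∈ stdSimplex ℝ Y) {t : ℝ}
    (ht : t ∈ Set.Icc (0 : ℝ) 1) :
    1 - maxGuessProb P Q ≤ √(powerSum (1 + t) P * powerSum (1 - t) Q)
      + powerSum (1 + t) P * powerSum (1 - t) Q := by
  classical
  set K := powerSum (1 + t) P * powerSum (1 - t) Q with hK
  set c : X → Y → ℝ := fun x y => if P x ≤ Q y then P x else 0 with hc
  set T : X → Y → ℝ := fun x y =>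
    (if 0 < P x then P x ^ (1 + t) else 0) * (if 0 < Q y then Q y ^ (1 - t) else 0) with hT
  have hT0 : ∀ x y, 0 ≤ T x y := by
    intro x y
    have := hP.1 x
    have := hQ.1 y
    simp only [hT]
    positivity
  have hKT : K = ∑ x, ∑ y, T x y := by
    rw [hK, powerSum_eq_sum_ite, powerSum_eq_sum_ite, Finset.sum_mul_sum]
  -- `T x y` dominates both the second moment on `P x ≤ Q y` and the mass lost on `P x > Q y`.
  have hsq : ∀ x y, (Q y)⁻¹ * (c x y ^ 2 * Q y) ≤ T x y := by
    intro x y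
    rcases (hQ.1 y).eq_or_lt with hq | hq
    · simpa [← hq] using hT0 x y
    rcases (hP.1 x).eq_or_lt with hp | hp
    · simpa [hc, ← hp] using hT0 x y
    by_cases h : P x ≤ Q y
    · simp only [hc, hT, h, hp, hq, if_true]
      calc (Q y)⁻¹ * (P x ^ 2 * Q y) = P x ^ (1 + t) * P x ^ (1 - t) := by
            rw [← Real.rpow_add hp, show 1 + t + (1 - t) = (2 : ℕ) by push_cast; ring,
              Real.rpow_natCast]
            field_simp
        _ ≤ P x ^ (1 + t) * Q y ^ (1 - t) := by
            gcongr
            linarith [ht.2]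
    · simpa [hc, h] using hT0 x y
  have htail : ∀ x y, Q y * (P x - c x y) ≤ T x y := by
    intro x y
    by_cases h : P x ≤ Q y
    · simpa [hc, h] using hT0 x y
    rcases (hQ.1 y).eq_or_lt with hq | hq
    · simpa [← hq] using hT0 x y
    have hlt := not_le.1 h
    have hp : 0 < P x := hq.trans hlt
    simp only [hc, hT, h, hp, hq, if_true, if_false, sub_zero]
    calc Q y * P x = P x * (Q y ^ t * Q y ^ (1 - t)) := by
          rw [← Real.rpow_add hq, show t + (1 - t) = 1 by ring, Real.rpow_one, mul_comm]
      _ ≤ P x * (P x ^ t * Q y ^ (1 - t)) := by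
          gcongr
          exact ht.1
      _ = P x ^ (1 + t) * Q y ^ (1 - t) := by
          rw [Real.rpow_add hp, Real.rpow_one, mul_assoc]
  obtain ⟨f, hf⟩ := exists_weighted_sum_sq_le hQ (w := fun y => (Q y)⁻¹)
    (fun y => inv_nonneg.2 (hQ.1 y)) c Finset.univ 0
  -- `S y` is the deviation of the truncated image mass at `y` from its mean.
  set S : Y → ℝ := fun y => ∑ x, c x y * ((if f x = y then 1 else 0) - Q y) with hS
  have hV : ∑ y, (Q y)⁻¹ * S y ^ 2 ≤ K := by
    have h1 : ∑ y, (Q y)⁻¹ * S y ^ 2 ≤ ∑ x, ∑ y, (Q y)⁻¹ * (c x y ^ 2 * Q y) := by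
      simpa [hS] using hf
    exact h1.trans (hKT ▸ Finset.sum_le_sum fun x _ => Finset.sum_le_sum fun y _ => hsq x y)
  have hS0 : ∀ y, Q y = 0 → S y = 0 := by
    intro y hy
    refine Finset.sum_eq_zero fun x _ => ?_
    have : c x y = 0 := by
      simp only [hc, hy]
      split_ifs with h
      exacts [le_antisymm h (hP.1 x), rfl]
    simp [this]
  -- Cauchy–Schwarz against the probability weights `Q`.
  have habs : ∑ y, |S y| ≤ √K := by
    refine Real.le_sqrt_of_sq_le (le_trans ?_ hV)
    have := Finset.sum_sq_le_sum_mul_sum_of_sq_le_mul Finset.univ (r := fun y => |S y|)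
      (f := Q) (g := fun y => (Q y)⁻¹ * S y ^ 2) (fun y _ => hQ.1 y)
      (fun y _ => mul_nonneg (inv_nonneg.2 (hQ.1 y)) (sq_nonneg _)) (fun y _ => by
        refine le_of_eq ?_
        rw [sq_abs]
        rcases eq_or_ne (Q y) 0 with h | h
        · simp [h, hS0 y h]
        · field_simp)
    rwa [hQ.2, one_mul] at this
  have hpt : ∀ y, Q y - min (∑ x with f x = y, P x) (Q y)
      ≤ |S y| + ∑ x, Q y * (P x - c x y) := by
    intro y
    have htail0 : 0 ≤ ∑ x, Q y * (P x - c x y) := by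
      refine Finset.sum_nonneg fun x _ => mul_nonneg (hQ.1 y) ?_
      simp only [hc]
      split_ifs
      · simp
      · simpa using hP.1 x
    rcases min_cases (∑ x with f x = y, P x) (Q y) with h | h
    · rw [h.1]
      have h1 : ∑ x, c x y * (if f x = y then 1 else 0) ≤ ∑ x with f x = y, P x := by
        rw [Finset.sum_filter]
        refine Finset.sum_le_sum fun x _ => ?_
        have := hP.1 x
        simp only [hc]
        split_ifs <;> simp [this]
      have h2 : S y = ∑ x, c x y * (if f x = y then 1 else 0) - Q y * ∑ x, c x y := by
        simp only [hS, mul_sub, Finset.sum_sub_distrib, Finset.mul_sum]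
        congr 1
        exact Finset.sum_congr rfl fun x _ => mul_comm _ _
      have h3 : ∑ x, Q y * (P x - c x y) = Q y - Q y * ∑ x, c x y := by
        rw [← Finset.mul_sum, Finset.sum_sub_distrib, hP.2]
        ring
      linarith [neg_abs_le (S y)]
    · rw [h.1, sub_self]
      positivity
  have hfin : 1 - ∑ y, min (∑ x with f x = y, P x) (Q y) ≤ √K + K := by
    rw [← hQ.2, ← Finset.sum_sub_distrib]
    refine (Finset.sum_le_sum fun y _ => hpt y).trans ?_
    rw [Finset.sum_add_distrib]
    refine add_le_add habs ?_
    rw [Finset.sum_comm, hKT]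
    exact Finset.sum_le_sum fun x _ => Finset.sum_le_sum fun y _ => htail x y
  linarith [sum_min_le_maxGuessProb hP hQ f]

/-- One-shot converse: outside two exceptional events, a successful guess puts `X` in the set `A` and
`Y` at an atom of mass at most `b`. -/
theorem maxGuessProb_le_of_sets [DecidableEq X] [DecidableEq Y] (hP : P ∈ stdSimplex ℝ X)
    (hQ : Q ∈ stdSimplex ℝ Y) (A : Finset X) (B : Finset Y) {b : ℝ} (hb : ∀ y ∈ B, Q y ≤ b)
    (hb0 : 0 ≤ b) :
    maxGuessProb P Q ≤ ∑ x ∈ Aᶜ, P x + ∑ y ∈ Bᶜ, Q y + A.card * b := by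
  refine maxGuessProb_le hP hQ fun R hR f => ?_
  have h1 : ∑ x ∈ Aᶜ, R (x, f x) ≤ ∑ x ∈ Aᶜ, P x :=
    Finset.sum_le_sum fun x _ => couplings_le_left hR x (f x)
  have h2 : ∑ x ∈ A, R (x, f x) ≤ ∑ x ∈ A, (∑ y ∈ Bᶜ, R (x, y) + b) := by
    refine Finset.sum_le_sum fun x _ => ?_
    by_cases hf : f x ∈ B
    · have := Finset.sum_nonneg (s := Bᶜ) fun y _ => hR.1.1 (x, y)
      linarith [couplings_le_right hR x (f x), hb _ hf]
    · have := Finset.single_le_sum (s := Bᶜ) (f := fun y => R (x, y)) (fun y _ => hR.1.1 (x, y))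
        (Finset.mem_compl.2 hf)
      linarith
  have h3 : ∑ x ∈ A, ∑ y ∈ Bᶜ, R (x, y) ≤ ∑ y ∈ Bᶜ, Q y := by
    rw [Finset.sum_comm]
    refine Finset.sum_le_sum fun y _ => ?_
    rw [← hR.2.2 y]
    exact Finset.sum_le_sum_of_subset_of_nonneg (Finset.subset_univ _) fun x _ _ => hR.1.1 _
  rw [Finset.sum_add_distrib, Finset.sum_const, nsmul_eq_mul] at h2
  rw [hitProb, ← Finset.sum_compl_add_sum A]
  linarith

end OneShot

end GuessingCoupling

namespace GuessingCoupling

/-! ### Product distributions -/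

section Product

variable {X Y : Type*} [Fintype X] [Fintype Y] {P : X → ℝ} {Q : Y → ℝ}

theorem prodDist_mem_stdSimplex (hP : P ∈ stdSimplex ℝ X) (n : ℕ) :
    prodDist P n ∈ stdSimplex ℝ (Fin n → X) :=
  ⟨fun _ => Finset.prod_nonneg fun _ _ => hP.1 _, by
    simp only [prodDist]
    rw [← Fintype.sum_pow, hP.2, one_pow]⟩

theorem powerSum_prodDist (hP : P ∈ stdSimplex ℝ X) (s : ℝ) (n : ℕ) :
    powerSum s (prodDist P n) = powerSum s P ^ n := by
  rw [powerSum_eq_sum_ite, powerSum_eq_sum_ite, Fintype.sum_pow]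
  refine Finset.sum_congr rfl fun x _ => ?_
  by_cases h : ∀ i, 0 < P (x i)
  · simp only [prodDist, h, if_true, Finset.prod_pos fun i _ => h i]
    exact (Real.finsetProd_rpow _ _ (fun i _ => (h i).le) s).symm
  · push Not at h
    obtain ⟨i, hi⟩ := h
    have h0 : prodDist P n x = 0 :=
      Finset.prod_eq_zero (Finset.mem_univ i) (le_antisymm hi (hP.1 _))
    rw [h0, if_neg (lt_irrefl _)]
    exact (Finset.prod_eq_zero (Finset.mem_univ i) (if_neg hi.not_gt)).symm

/-- Using independent copies of an optimal coupling and guessing each letter separately succeeds with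
the product of the single-letter probabilities. -/
theorem pow_maxGuessProb_le (hP : P ∈ stdSimplex ℝ X) (hQ : Q ∈ stdSimplex ℝ Y) (n : ℕ) :
    maxGuessProb P Q ^ n ≤ maxGuessProb (prodDist P n) (prodDist Q n) := by
  obtain ⟨R, hR, f, hf⟩ := (isGreatest_maxGuessProb hP hQ).1
  set S : (Fin n → X) × (Fin n → Y) → ℝ := fun z => ∏ i, R (z.1 i, z.2 i) with hS
  have hSx : ∀ x, ∑ y, S (x, y) = prodDist P n x := by
    intro x
    simp only [hS, prodDist, ← hR.2.1]
    exact (Fintype.prod_sum fun i y => R (x i, y)).symm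
  have hSy : ∀ y, ∑ x, S (x, y) = prodDist Q n y := by
    intro y
    simp only [hS, prodDist, ← hR.2.2]
    exact (Fintype.prod_sum fun i x => R (x, y i)).symm
  have hmem : S ∈ couplings (prodDist P n) (prodDist Q n) :=
    ⟨⟨fun z => Finset.prod_nonneg fun i _ => hR.1.1 _, by
      rw [Fintype.sum_prod_type]
      simp only [hSx, (prodDist_mem_stdSimplex hP n).2]⟩, hSx, hSy⟩
  have := hitProb_le_maxGuessProb (prodDist_mem_stdSimplex hP n) (prodDist_mem_stdSimplex hQ n)
    hmem fun x i => f (x i)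
  rw [hf, hitProb, Fintype.sum_pow]
  exact this

/-- Always guessing a most likely letter succeeds with probability at least `1 / |Y|`. -/
theorem inv_card_le_maxGuessProb (hP : P ∈ stdSimplex ℝ X) (hQ : Q ∈ stdSimplex ℝ Y) :
    (Fintype.card Y : ℝ)⁻¹ ≤ maxGuessProb P Q := by
  classical
  obtain ⟨y, hy⟩ : ∃ y, (Fintype.card Y : ℝ)⁻¹ ≤ Q y := by
    by_contra! h
    have hne : (Finset.univ : Finset Y).Nonempty := by
      by_contra hne
      rw [Finset.not_nonempty_iff_eq_empty] at hne
      simpa [hne] using hQ.2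
    have := Finset.sum_lt_sum_of_nonempty hne fun y _ => h y
    rw [hQ.2, Finset.sum_const, nsmul_eq_mul, Finset.card_univ, mul_inv_cancel₀] at this
    · exact lt_irrefl _ this
    · exact_mod_cast (Finset.card_pos.2 hne).ne'
  refine hy.trans (le_trans ?_ (sum_min_le_maxGuessProb hP hQ fun _ => y))
  have h1 : min (∑ x with y = y, P x) (Q y) = Q y := by
    rw [min_eq_right]
    simpa [hP.2] using hQ.2 ▸ Finset.single_le_sum (fun z _ => hQ.1 z) (Finset.mem_univ y)
  rw [← h1]
  exact Finset.single_le_sum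
    (f := fun z => min (∑ x with y = z, P x) (Q z))
    (fun z _ => le_min (Finset.sum_nonneg fun x _ => hP.1 x) (hQ.1 z)) (Finset.mem_univ y)

end Product

/-! ### Exponential rates -/

section Rate

theorem coe_le_expRate {a : ℕ → ℝ} {r C : ℝ} (hC : 0 < C)
    (h : ∀ n : ℕ, a n ≤ C * Real.exp (-r * n)) : (r : EReal) ≤ expRate a := by
  have hlim : Tendsto (fun n : ℕ => ((r - Real.log C / n : ℝ) : EReal)) atTop (𝓝 (r : EReal)) := by
    refine (continuous_coe_real_ereal.tendsto r).comp ?_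
    simpa using tendsto_const_nhds.sub (tendsto_const_div_atTop_nhds_zero_nat (Real.log C))
  rw [← hlim.liminf_eq]
  refine liminf_le_liminf ?_
  filter_upwards [eventually_gt_atTop 0] with n hn
  have hn' : (0 : ℝ) < n := by exact_mod_cast hn
  have hlog : ENNReal.log (ENNReal.ofReal (a n)) ≤ ((Real.log C + -r * n : ℝ) : EReal) := by
    rw [← Real.log_exp (-r * n), ← Real.log_mul hC.ne' (Real.exp_pos _).ne',
      ← ENNReal.log_ofReal_of_pos (mul_pos hC (Real.exp_pos _))]
    exact ENNReal.log_le_log (ENNReal.ofReal_le_ofReal (h n))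
  have hdiv := EReal.div_le_div_right_of_nonneg (c := (n : EReal)) (by positivity) hlog
  rw [← EReal.coe_natCast, ← EReal.coe_div] at hdiv
  rw [EReal.le_neg, ← EReal.coe_neg]
  refine hdiv.trans (le_of_eq ?_)
  congr 1
  field_simp
  ring

theorem expRate_le_coe {a : ℕ → ℝ} {r C : ℝ} (hC : 0 < C)
    (h : ∀ n : ℕ, C * Real.exp (-r * n) ≤ a n) : expRate a ≤ (r : EReal) := by
  have hlim : Tendsto (fun n : ℕ => ((r - Real.log C / n : ℝ) : EReal)) atTop (𝓝 (r : EReal)) := by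
    refine (continuous_coe_real_ereal.tendsto r).comp ?_
    simpa using tendsto_const_nhds.sub (tendsto_const_div_atTop_nhds_zero_nat (Real.log C))
  rw [← hlim.liminf_eq]
  refine liminf_le_liminf ?_
  filter_upwards [eventually_gt_atTop 0] with n hn
  have hn' : (0 : ℝ) < n := by exact_mod_cast hn
  have hlog : ((Real.log C + -r * n : ℝ) : EReal) ≤ ENNReal.log (ENNReal.ofReal (a n)) := by
    rw [← Real.log_exp (-r * n), ← Real.log_mul hC.ne' (Real.exp_pos _).ne',
      ← ENNReal.log_ofReal_of_pos (mul_pos hC (Real.exp_pos _))]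
    exact ENNReal.log_le_log (ENNReal.ofReal_le_ofReal (h n))
  have hdiv := EReal.div_le_div_right_of_nonneg (c := (n : EReal)) (by positivity) hlog
  rw [← EReal.coe_natCast, ← EReal.coe_div] at hdiv
  rw [EReal.neg_le, ← EReal.coe_neg]
  refine le_trans (le_of_eq ?_) hdiv
  congr 1
  field_simp
  ring

theorem tendsto_zero_of_le_exp {a : ℕ → ℝ} {r C : ℝ} (hr : 0 < r) (ha : ∀ n, 0 ≤ a n)
    (h : ∀ n : ℕ, a n ≤ C * Real.exp (-r * n)) : Tendsto a atTop (𝓝 0) := by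
  refine squeeze_zero ha h ?_
  have : Tendsto (fun n : ℕ => Real.exp (-r * n)) atTop (𝓝 0) :=
    Real.tendsto_exp_atBot.comp
      (tendsto_natCast_atTop_atTop.const_mul_atTop_of_neg (neg_lt_zero.2 hr))
  simpa using this.const_mul C

end Rate

/-! ### The Rényi exponent -/

section Renyi

variable {X Y : Type*} [Fintype X] [Fintype Y] {P : X → ℝ} {Q : Y → ℝ}

theorem powerSum_pos (hP : P ∈ stdSimplex ℝ X) (s : ℝ) : 0 < powerSum s P := by
  refine Finset.sum_pos (fun x hx => Real.rpow_pos_of_pos (Finset.mem_filter.1 hx).2 s) ?_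
  by_contra h
  rw [Finset.not_nonempty_iff_eq_empty, Finset.filter_eq_empty_iff] at h
  have : ∑ x, P x = 0 := Finset.sum_eq_zero fun x hx => le_antisymm (not_lt.1 (h hx)) (hP.1 x)
  rw [hP.2] at this
  exact one_ne_zero this

theorem powerSum_one (hP : P ∈ stdSimplex ℝ X) : powerSum 1 P = 1 := by
  rw [powerSum_eq_sum_ite]
  refine (Finset.sum_congr rfl fun x _ => ?_).trans hP.2
  split_ifs with h
  · exact Real.rpow_one _
  · exact le_antisymm (hP.1 x) (not_lt.1 h)

theorem continuous_powerSum (P : X → ℝ) : Continuous fun s => powerSum s P := by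
  unfold powerSum
  exact continuous_finsetSum _ fun x hx =>
    Real.continuous_const_rpow (Finset.mem_filter.1 hx).2.ne'

theorem hasDerivAt_powerSum_one (hP : P ∈ stdSimplex ℝ X) :
    HasDerivAt (fun s => powerSum s P) (-shannonEntropy P) 1 := by
  have h : HasDerivAt (fun s => powerSum s P)
      (∑ x with 0 < P x, Real.log (P x) * 1 * P x ^ (1 : ℝ)) 1 := by
    unfold powerSum
    exact HasDerivAt.fun_sum fun x hx => (hasDerivAt_id 1).const_rpow (Finset.mem_filter.1 hx).2
  convert h using 1
  rw [shannonEntropy, Finset.sum_filter, ← Finset.sum_neg_distrib]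
  refine Finset.sum_congr rfl fun x _ => ?_
  split_ifs with hx
  · simp [Real.negMulLog, mul_comm]
  · simp [le_antisymm (not_lt.1 hx) (hP.1 x)]

/-- The exponent `t (H_{1+t}(P) - H_{1-t}(Q))`, in a form that is smooth also at `t = 0`. -/
theorem mul_renyiEntropy_sub (hP : P ∈ stdSimplex ℝ X) (hQ : Q ∈ stdSimplex ℝ Y) (t : ℝ) :
    t * (renyiEntropy (1 + t) P - renyiEntropy (1 - t) Q)
      = -Real.log (powerSum (1 + t) P * powerSum (1 - t) Q) := by
  rcases eq_or_ne t 0 with rfl | ht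
  · simp [powerSum_one hP, powerSum_one hQ]
  · rw [renyiEntropy, renyiEntropy, if_neg (by simpa using ht), if_neg (by simpa using ht),
      Real.log_mul (powerSum_pos hP _).ne' (powerSum_pos hQ _).ne']
    simp only [powerSum]
    rw [show 1 - (1 + t) = -t by ring, show 1 - (1 - t) = t by ring]
    field_simp
    ring

theorem exists_isMaxOn_renyi (hP : P ∈ stdSimplex ℝ X) (hQ : Q ∈ stdSimplex ℝ Y) :
    ∃ t ∈ Set.Icc (0 : ℝ) 1,
      IsMaxOn (fun t => t * (renyiEntropy (1 + t) P - renyiEntropy (1 - t) Q)) (Set.Icc 0 1) t := by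
  refine isCompact_Icc.exists_isMaxOn ⟨0, by simp⟩ ?_
  simp only [mul_renyiEntropy_sub hP hQ]
  refine (Continuous.log ?_ fun t => ?_).neg.continuousOn
  · exact ((continuous_powerSum P).comp (by fun_prop)).mul
      ((continuous_powerSum Q).comp (by fun_prop))
  · exact (mul_pos (powerSum_pos hP _) (powerSum_pos hQ _)).ne'

/-- The exponent vanishes at `t = 0`, where its derivative is `H(P) - H(Q)`. -/
theorem exists_renyi_pos (hP : P ∈ stdSimplex ℝ X) (hQ : Q ∈ stdSimplex ℝ Y)
    (h : shannonEntropy Q < shannonEntropy P) :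
    ∃ t ∈ Set.Icc (0 : ℝ) 1, 0 < t * (renyiEntropy (1 + t) P - renyiEntropy (1 - t) Q) := by
  simp only [mul_renyiEntropy_sub hP hQ]
  have hA : HasDerivAt (fun t => powerSum (1 + t) P) (-shannonEntropy P) 0 :=
    HasDerivAt.comp_const_add (1 : ℝ) 0 (by simpa using hasDerivAt_powerSum_one hP)
  have hB : HasDerivAt (fun t => powerSum (1 - t) Q) (- -shannonEntropy Q) 0 :=
    HasDerivAt.comp_const_sub (1 : ℝ) 0 (by simpa using hasDerivAt_powerSum_one hQ)
  have hφ := ((hA.mul hB).log (mul_pos (powerSum_pos hP _) (powerSum_pos hQ _)).ne').neg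
  have hslope := (hasDerivAt_iff_tendsto_slope_zero.1 hφ).mono_left
    (nhdsWithin_mono 0 (s := Set.Ioi 0) fun t (ht : 0 < t) => ht.ne')
  have hpos : ∀ᶠ t : ℝ in 𝓝[>] 0,
      0 < t⁻¹ * -Real.log (powerSum (1 + t) P * powerSum (1 - t) Q) := by
    refine (hslope.eventually_const_lt (u := 0) ?_).mono fun t ht => ?_
    · simp [powerSum_one hP, powerSum_one hQ]
      linarith
    · simpa [powerSum_one hP, powerSum_one hQ] using ht
  obtain ⟨t, ht, ht0, ht1⟩ :=
    (hpos.and (Ioo_mem_nhdsGT (show (0 : ℝ) < 1 by norm_num))).exists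
  exact ⟨t, ⟨ht0.le, ht1.le⟩, pos_of_mul_pos_right ht (inv_nonneg.2 ht0.le)⟩

theorem one_sub_maxGuessProb_prodDist_le (hP : P ∈ stdSimplex ℝ X) (hQ : Q ∈ stdSimplex ℝ Y)
    {t : ℝ} (ht : t ∈ Set.Icc (0 : ℝ) 1) {M : ℝ}
    (hM : t * (renyiEntropy (1 + t) P - renyiEntropy (1 - t) Q) = M) (hM0 : 0 ≤ M) (n : ℕ) :
    1 - maxGuessProb (prodDist P n) (prodDist Q n) ≤ 2 * Real.exp (-(1 / 2 * M) * n) := by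
  have h := one_sub_maxGuessProb_le (prodDist_mem_stdSimplex hP n) (prodDist_mem_stdSimplex hQ n) ht
  have hK : powerSum (1 + t) P * powerSum (1 - t) Q = Real.exp (-M) := by
    rw [← hM, mul_renyiEntropy_sub hP hQ, neg_neg,
      Real.exp_log (mul_pos (powerSum_pos hP _) (powerSum_pos hQ _))]
  rw [powerSum_prodDist hP, powerSum_prodDist hQ, ← mul_pow, hK, ← Real.exp_nat_mul] at h
  have hsqrt : √(Real.exp (n * -M)) = Real.exp (-(1 / 2 * M) * n) := by
    rw [← Real.exp_half]
    congr 1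
    ring
  have hle : Real.exp (n * -M) ≤ Real.exp (-(1 / 2 * M) * n) := by
    refine Real.exp_le_exp.2 ?_
    have : 0 ≤ M * n := by positivity
    linarith
  rw [hsqrt] at h
  linarith

end Renyi

/-! ### Typical words and the converse bound -/

section Auxiliary

variable {X : Type*} [Fintype X] {P : X → ℝ} {n : ℕ}

theorem exp_neg_le_quadratic {ε : ℝ} (h0 : 0 ≤ ε) : Real.exp (-ε) ≤ 1 - ε + ε ^ 2 / 2 := by
  rw [Real.exp_neg]
  have h := Real.quadratic_le_exp_of_nonneg h0
  refine (inv_anti₀ (by positivity) h).trans ?_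
  rw [inv_le_iff_one_le_mul₀ (by positivity)]
  nlinarith [sq_nonneg (ε ^ 2)]

theorem typDelta_le {X : Type*} {P : X → ℝ} (hP : ∀ x, 0 ≤ P x) (ε : ℝ) {a : X} (ha : 0 < P a) :
    typDelta ε P ≤ 1 / 3 * ε ^ 2 * P a := by
  refine mul_le_mul_of_nonneg_left (csInf_le ⟨0, ?_⟩ ⟨a, ha, rfl⟩) (by positivity)
  rintro _ ⟨x, -, rfl⟩
  exact hP x

theorem typDelta_pos (hP : P ∈ stdSimplex ℝ X) {ε : ℝ} (hε : 0 < ε) :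
    0 < typDelta ε P := by
  have hne : (P '' {x | 0 < P x}).Nonempty := by
    by_contra h
    have h0 : ∀ x, P x = 0 := fun x =>
      le_antisymm (not_lt.1 fun hx => h ⟨_, x, hx, rfl⟩) (hP.1 x)
    simpa [h0] using hP.2
  obtain ⟨x, hx, h⟩ := hne.csInf_mem (Set.toFinite _)
  rw [typDelta, ← h]
  have : 0 < P x := hx
  positivity

theorem log_nonpos_of_mem_stdSimplex (hP : P ∈ stdSimplex ℝ X) (a : X) : Real.log (P a) ≤ 0 :=
  Real.log_nonpos (hP.1 a)
    (hP.2 ▸ Finset.single_le_sum (fun b _ => hP.1 b) (Finset.mem_univ a))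

theorem pos_of_prodDist_ne_zero (hP : P ∈ stdSimplex ℝ X) {x : Fin n → X}
    (h : prodDist P n x ≠ 0) (i : Fin n) : 0 < P (x i) :=
  (hP.1 _).lt_of_ne' (Finset.prod_ne_zero_iff.1 h i (Finset.mem_univ i))

/-- A union bound over the letters of the support: words that are atypical, in the sense `p a`, for
some letter `a` of positive probability. -/
theorem sum_prodDist_le_card_mul_exp (hP : P ∈ stdSimplex ℝ X) (ε : ℝ)
    (p : X → (Fin n → X) → Prop) [∀ a x, Decidable (p a x)]
    (hp : ∀ a, ∑ x with p a x, prodDist P n x ≤ Real.exp (-(1 / 3 * ε ^ 2 * P a) * n))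
    (S : Finset (Fin n → X)) (hS : ∀ x ∈ S, prodDist P n x ≠ 0 → ∃ a, 0 < P a ∧ p a x) :
    ∑ x ∈ S, prodDist P n x ≤ Fintype.card X * Real.exp (-typDelta ε P * n) := by
  have hp0 := (prodDist_mem_stdSimplex hP n).1
  calc ∑ x ∈ S, prodDist P n x
      ≤ ∑ x ∈ S, ∑ a with 0 < P a, if p a x then prodDist P n x else 0 := by
        refine Finset.sum_le_sum fun x hx => ?_
        have hterm : ∀ a, 0 ≤ if p a x then prodDist P n x else 0 := by
          intro a
          split_ifs
          exacts [hp0 x, le_rfl]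
        by_cases h0 : prodDist P n x = 0
        · exact h0.le.trans (Finset.sum_nonneg fun a _ => hterm a)
        · obtain ⟨a, ha, hpa⟩ := hS x hx h0
          refine le_trans ?_ (Finset.single_le_sum (fun a _ => hterm a)
            (Finset.mem_filter.2 ⟨Finset.mem_univ a, ha⟩))
          rw [if_pos hpa]
    _ ≤ ∑ x, ∑ a with 0 < P a, if p a x then prodDist P n x else 0 := by
        refine Finset.sum_le_sum_of_subset_of_nonneg (Finset.subset_univ _) fun x _ _ =>
          Finset.sum_nonneg fun a _ => ?_
        split_ifs
        exacts [hp0 x, le_rfl]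
    _ = ∑ a with 0 < P a, ∑ x with p a x, prodDist P n x := by
        rw [Finset.sum_comm]
        simp only [Finset.sum_filter]
    _ ≤ ∑ a with 0 < P a, Real.exp (-typDelta ε P * n) := by
        refine Finset.sum_le_sum fun a ha => (hp a).trans (Real.exp_le_exp.2 ?_)
        have := typDelta_le hP.1 ε (Finset.mem_filter.1 ha).2
        have : typDelta ε P * n ≤ 1 / 3 * ε ^ 2 * P a * n := by gcongr
        linarith
    _ ≤ Fintype.card X * Real.exp (-typDelta ε P * n) := by
        rw [Finset.sum_const, nsmul_eq_mul]
        gcongr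
        exact Finset.card_le_univ _

end Auxiliary

section Typical

variable {X Y : Type*} [Fintype X] [Fintype Y] [DecidableEq X] [DecidableEq Y]
  {P : X → ℝ} {Q : Y → ℝ} {n : ℕ}

/-- The number of occurrences of the letter `a` in the word `x`. -/
def occurrences (a : X) (x : Fin n → X) : ℝ :=
  ∑ i, if x i = a then 1 else 0

theorem prodDist_eq_exp {x : Fin n → X} (h : ∀ i, 0 < P (x i)) :
    prodDist P n x = Real.exp (∑ a, occurrences a x * Real.log (P a)) := by
  have : ∑ a, occurrences a x * Real.log (P a) = ∑ i, Real.log (P (x i)) := by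
    simp only [occurrences, Finset.sum_mul]
    rw [Finset.sum_comm]
    simp
  rw [this, Real.exp_sum]
  exact Finset.prod_congr rfl fun i _ => (Real.exp_log (h i)).symm

/-- Chernoff's bound for the number of occurrences of a letter, for both tails: the upper one when
`l > 0` and the lower one when `l < 0`. -/
theorem sum_prodDist_le_exp (hP : P ∈ stdSimplex ℝ X) (a : X) (l s : ℝ) :
    ∑ x : Fin n → X with l * s ≤ l * occurrences a x, prodDist P n x
      ≤ Real.exp (n * (P a * (Real.exp l - 1)) - l * s) := by
  have hmgf : ∑ x : Fin n → X, prodDist P n x * Real.exp (l * occurrences a x)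
      = (1 + P a * (Real.exp l - 1)) ^ n := by
    have h1 : ∑ b, P b * Real.exp (l * if b = a then 1 else 0) = 1 + P a * (Real.exp l - 1) := by
      have : ∀ b, P b * Real.exp (l * if b = a then 1 else 0)
          = P b + if b = a then P b * (Real.exp l - 1) else 0 := by
        intro b
        split_ifs
        · rw [mul_one]
          ring
        · simp
      simp only [this, Finset.sum_add_distrib, hP.2, Finset.sum_ite_eq', Finset.mem_univ, if_true]
    rw [← h1, Fintype.sum_pow]
    refine Finset.sum_congr rfl fun x _ => ?_
    rw [occurrences, Finset.mul_sum, Real.exp_sum, prodDist, ← Finset.prod_mul_distrib]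
  have hbase : 1 + P a * (Real.exp l - 1) ≤ Real.exp (P a * (Real.exp l - 1)) := by
    linarith [Real.add_one_le_exp (P a * (Real.exp l - 1))]
  have hPa : P a ≤ 1 := hP.2 ▸ Finset.single_le_sum (fun b _ => hP.1 b) (Finset.mem_univ a)
  have hbase0 : 0 ≤ 1 + P a * (Real.exp l - 1) := by
    nlinarith [mul_nonneg (hP.1 a) (Real.exp_pos l).le]
  have hp0 := (prodDist_mem_stdSimplex hP n).1
  calc ∑ x : Fin n → X with l * s ≤ l * occurrences a x, prodDist P n x
      ≤ ∑ x : Fin n → X with l * s ≤ l * occurrences a x,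
          prodDist P n x * Real.exp (l * occurrences a x) * Real.exp (-(l * s)) := by
        refine Finset.sum_le_sum fun x hx => ?_
        rw [mul_assoc, ← Real.exp_add]
        refine le_mul_of_one_le_right (hp0 x) (Real.one_le_exp ?_)
        linarith [(Finset.mem_filter.1 hx).2]
    _ ≤ ∑ x : Fin n → X, prodDist P n x * Real.exp (l * occurrences a x) * Real.exp (-(l * s)) :=
        Finset.sum_le_sum_of_subset_of_nonneg (Finset.subset_univ _) fun x _ _ =>
          mul_nonneg (mul_nonneg (hp0 x) (Real.exp_pos _).le) (Real.exp_pos _).le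
    _ = (1 + P a * (Real.exp l - 1)) ^ n * Real.exp (-(l * s)) := by
        rw [← Finset.sum_mul, hmgf]
    _ ≤ Real.exp (P a * (Real.exp l - 1)) ^ n * Real.exp (-(l * s)) := by
        gcongr
    _ = Real.exp (n * (P a * (Real.exp l - 1)) - l * s) := by
        rw [← Real.exp_nat_mul, ← Real.exp_add, ← sub_eq_add_neg]

theorem sum_prodDist_upper_le (hP : P ∈ stdSimplex ℝ X) {ε : ℝ} (hε : ε ∈ Set.Ioo (0 : ℝ) 1)
    (a : X) :
    ∑ x : Fin n → X with (1 + ε) * (n * P a) < occurrences a x, prodDist P n x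
      ≤ Real.exp (-(1 / 3 * ε ^ 2 * P a) * n) := by
  obtain ⟨h0, h1⟩ := hε
  have hlog : ε ^ 2 / 3 ≤ (1 + ε) * Real.log (1 + ε) - ε := by
    have h := Real.le_log_one_add_of_nonneg h0.le
    have h2 : ε + ε ^ 2 / 3 ≤ (1 + ε) * (2 * ε / (ε + 2)) := by
      rw [mul_div_assoc', le_div_iff₀ (by linarith)]
      nlinarith [mul_pos (pow_pos h0 2) (sub_pos.2 h1)]
    nlinarith [mul_le_mul_of_nonneg_left h (show 0 ≤ 1 + ε by linarith)]
  -- The optimal Chernoff parameter is `log (1 + ε)`.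
  have hl : 0 ≤ Real.log (1 + ε) := Real.log_nonneg (by linarith)
  refine le_trans (Finset.sum_le_sum_of_subset_of_nonneg ?_ fun x _ _ =>
    (prodDist_mem_stdSimplex hP n).1 x)
    ((sum_prodDist_le_exp hP a (Real.log (1 + ε)) ((1 + ε) * (n * P a))).trans ?_)
  · intro x hx
    simp only [Finset.mem_filter, Finset.mem_univ, true_and] at hx ⊢
    exact mul_le_mul_of_nonneg_left hx.le hl
  · rw [Real.exp_log (by linarith)]
    refine Real.exp_le_exp.2 ?_
    have := mul_le_mul_of_nonneg_left hlog (mul_nonneg n.cast_nonneg (hP.1 a))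
    linarith

theorem sum_prodDist_lower_le (hP : P ∈ stdSimplex ℝ X) {ε : ℝ} (hε : 0 ≤ ε) (a : X) :
    ∑ x : Fin n → X with occurrences a x < (1 - ε) * (n * P a), prodDist P n x
      ≤ Real.exp (-(1 / 3 * ε ^ 2 * P a) * n) := by
  refine le_trans (Finset.sum_le_sum_of_subset_of_nonneg ?_ fun x _ _ =>
    (prodDist_mem_stdSimplex hP n).1 x)
    ((sum_prodDist_le_exp hP a (-ε) ((1 - ε) * (n * P a))).trans ?_)
  -- The Chernoff parameter `-ε` even gives the rate `ε² P(a) / 2`.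
  · intro x hx
    simp only [Finset.mem_filter, Finset.mem_univ, true_and] at hx ⊢
    nlinarith
  · refine Real.exp_le_exp.2 ?_
    have hnP : 0 ≤ n * P a := mul_nonneg n.cast_nonneg (hP.1 a)
    have := mul_le_mul_of_nonneg_left (exp_neg_le_quadratic hε) hnP
    have := mul_nonneg hnP (sq_nonneg ε)
    linarith

/-- Few words of substantial probability: a set of overwhelming probability with at most
`exp (n (1 + ε) H(P))` elements. -/
theorem exists_typical_small (hP : P ∈ stdSimplex ℝ X) {ε : ℝ} (hε : ε ∈ Set.Ioo (0 : ℝ) 1)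
    (n : ℕ) :
    ∃ A : Finset (Fin n → X), (A.card : ℝ) ≤ Real.exp ((1 + ε) * shannonEntropy P * n) ∧
      ∑ x ∈ Aᶜ, prodDist P n x ≤ Fintype.card X * Real.exp (-typDelta ε P * n) := by
  classical
  set A : Finset (Fin n → X) := Finset.univ.filter fun x =>
    prodDist P n x ≠ 0 ∧ ∀ a, 0 < P a → occurrences a x ≤ (1 + ε) * (n * P a) with hA
  refine ⟨A, ?_, ?_⟩
  · have hlow : ∀ x ∈ A, Real.exp (-((1 + ε) * shannonEntropy P * n)) ≤ prodDist P n x := by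
      intro x hx
      obtain ⟨hx0, hx⟩ := (Finset.mem_filter.1 hx).2
      have hpos := pos_of_prodDist_ne_zero hP hx0
      rw [prodDist_eq_exp hpos]
      refine Real.exp_le_exp.2 ?_
      have : -((1 + ε) * shannonEntropy P * n)
          = ∑ a, (1 + ε) * (n * P a) * Real.log (P a) := by
        simp only [shannonEntropy, Real.negMulLog, Finset.mul_sum, Finset.sum_mul,
          ← Finset.sum_neg_distrib]
        exact Finset.sum_congr rfl fun a _ => by ring
      rw [this]
      refine Finset.sum_le_sum fun a _ => ?_
      by_cases ha : 0 < P a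
      · exact mul_le_mul_of_nonpos_right (hx a ha) (log_nonpos_of_mem_stdSimplex hP a)
      · simp [le_antisymm (not_lt.1 ha) (hP.1 a)]
    have hsum : ∑ x ∈ A, prodDist P n x ≤ 1 :=
      (prodDist_mem_stdSimplex hP n).2 ▸ Finset.sum_le_sum_of_subset_of_nonneg
        (Finset.subset_univ _) fun x _ _ => (prodDist_mem_stdSimplex hP n).1 x
    have := (Finset.card_nsmul_le_sum A _ _ hlow).trans hsum
    rwa [nsmul_eq_mul, Real.exp_neg, ← div_eq_mul_inv, div_le_one (Real.exp_pos _)] at this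
  · refine sum_prodDist_le_card_mul_exp hP ε _ (sum_prodDist_upper_le hP hε) _ fun x hx hx0 => ?_
    simp only [hA, Finset.mem_compl, Finset.mem_filter, Finset.mem_univ, true_and, not_and] at hx
    have := hx hx0
    push Not at this
    exact this

/-- A set of overwhelming probability all of whose elements have probability at most
`exp (-n (1 - ε) H(P))`. -/
theorem exists_typical_light (hP : P ∈ stdSimplex ℝ X) {ε : ℝ} (hε : ε ∈ Set.Ioo (0 : ℝ) 1)
    (n : ℕ) :
    ∃ B : Finset (Fin n → X),
      (∀ x ∈ B, prodDist P n x ≤ Real.exp (-((1 - ε) * shannonEntropy P * n))) ∧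
      ∑ x ∈ Bᶜ, prodDist P n x ≤ Fintype.card X * Real.exp (-typDelta ε P * n) := by
  classical
  set B : Finset (Fin n → X) := Finset.univ.filter fun x =>
    ∀ a, 0 < P a → (1 - ε) * (n * P a) ≤ occurrences a x with hB
  refine ⟨B, fun x hx => ?_, ?_⟩
  · by_cases hx0 : prodDist P n x = 0
    · exact hx0 ▸ (Real.exp_pos _).le
    have hx := (Finset.mem_filter.1 hx).2
    have hpos := pos_of_prodDist_ne_zero hP hx0
    rw [prodDist_eq_exp hpos]
    refine Real.exp_le_exp.2 ?_
    have : -((1 - ε) * shannonEntropy P * n)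
        = ∑ a, (1 - ε) * (n * P a) * Real.log (P a) := by
      simp only [shannonEntropy, Real.negMulLog, Finset.mul_sum, Finset.sum_mul,
        ← Finset.sum_neg_distrib]
      exact Finset.sum_congr rfl fun a _ => by ring
    rw [this]
    refine Finset.sum_le_sum fun a _ => ?_
    by_cases ha : 0 < P a
    · exact mul_le_mul_of_nonpos_right (hx a ha) (log_nonpos_of_mem_stdSimplex hP a)
    · simp [le_antisymm (not_lt.1 ha) (hP.1 a)]
  · refine sum_prodDist_le_card_mul_exp hP ε _ (sum_prodDist_lower_le hP hε.1.le) _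
      fun x hx _ => ?_
    simp only [hB, Finset.mem_compl, Finset.mem_filter, Finset.mem_univ, true_and] at hx
    push Not at hx
    exact hx

/-- The one-shot converse on the two typical sets, which have product mass at most
`exp (-n ((1 - ε) H(Q) - (1 + ε) H(P)))`. -/
theorem maxGuessProb_prodDist_le (hP : P ∈ stdSimplex ℝ X) (hQ : Q ∈ stdSimplex ℝ Y) {ε : ℝ}
    (hε : ε ∈ Set.Ioo (0 : ℝ) 1) (n : ℕ) :
    maxGuessProb (prodDist P n) (prodDist Q n) ≤ (Fintype.card X + Fintype.card Y + 1)
      * Real.exp (-(min (min (typDelta ε P) (typDelta ε Q))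
        ((1 - ε) * shannonEntropy Q - (1 + ε) * shannonEntropy P)) * n) := by
  obtain ⟨A, hA, hA'⟩ := exists_typical_small hP hε n
  obtain ⟨B, hB, hB'⟩ := exists_typical_light hQ hε n
  have h := maxGuessProb_le_of_sets (prodDist_mem_stdSimplex hP n) (prodDist_mem_stdSimplex hQ n)
    A B hB (Real.exp_pos _).le
  set m := min (min (typDelta ε P) (typDelta ε Q))
    ((1 - ε) * shannonEntropy Q - (1 + ε) * shannonEntropy P) with hm
  have hexp : ∀ {r : ℝ}, m ≤ r → Real.exp (-r * n) ≤ Real.exp (-m * n) := by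
    intro r hr
    gcongr
  have h1 : ∑ x ∈ Aᶜ, prodDist P n x ≤ Fintype.card X * Real.exp (-m * n) :=
    hA'.trans (by gcongr; exact (min_le_left _ _).trans (min_le_left _ _))
  have h2 : ∑ x ∈ Bᶜ, prodDist Q n x ≤ Fintype.card Y * Real.exp (-m * n) :=
    hB'.trans (by gcongr; exact (min_le_left _ _).trans (min_le_right _ _))
  have h3 : A.card * Real.exp (-((1 - ε) * shannonEntropy Q * n)) ≤ Real.exp (-m * n) := by
    refine (mul_le_mul_of_nonneg_right hA (Real.exp_pos _).le).trans ?_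
    rw [← Real.exp_add]
    refine le_trans (le_of_eq ?_) (hexp (min_le_right _ _))
    congr 1
    ring
  linarith

end Typical

end GuessingCoupling

open GuessingCoupling in
theorem mainTheorem2 {X Y : Type*} [Fintype X] [Fintype Y] (P : X → ℝ) (Q : Y → ℝ)
    (hP : P ∈ stdSimplex ℝ X) (hQ : Q ∈ stdSimplex ℝ Y) :
    (GuessingCoupling.shannonEntropy Q < GuessingCoupling.shannonEntropy P →
      Tendsto (fun n : ℕ => GuessingCoupling.maxGuessProb
          (GuessingCoupling.prodDist P n) (GuessingCoupling.prodDist Q n)) atTop (𝓝 1) ∧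
      GuessingCoupling.AtLeastExpFast (fun n : ℕ => 1 - GuessingCoupling.maxGuessProb
          (GuessingCoupling.prodDist P n) (GuessingCoupling.prodDist Q n)) ∧
      ∃ M : ℝ,
        IsGreatest ((fun t : ℝ => t * (GuessingCoupling.renyiEntropy (1 + t) P
            - GuessingCoupling.renyiEntropy (1 - t) Q)) '' Set.Icc 0 1) M ∧
        ((1 / 2 * M : ℝ) : EReal) ≤
          GuessingCoupling.expRate (fun n : ℕ => 1 - GuessingCoupling.maxGuessProb
            (GuessingCoupling.prodDist P n) (GuessingCoupling.prodDist Q n))) ∧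
    (GuessingCoupling.shannonEntropy P < GuessingCoupling.shannonEntropy Q →
      Tendsto (fun n : ℕ => GuessingCoupling.maxGuessProb
          (GuessingCoupling.prodDist P n) (GuessingCoupling.prodDist Q n)) atTop (𝓝 0) ∧
      GuessingCoupling.ExpFast (fun n : ℕ => GuessingCoupling.maxGuessProb
          (GuessingCoupling.prodDist P n) (GuessingCoupling.prodDist Q n)) ∧
      GuessingCoupling.expRate (fun n : ℕ => GuessingCoupling.maxGuessProb
          (GuessingCoupling.prodDist P n) (GuessingCoupling.prodDist Q n))
        ≤ ((Real.log (Fintype.card Y) : ℝ) : EReal) ∧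
      (⨆ ε ∈ Set.Ioo (0 : ℝ) 1,
        ((min (min (GuessingCoupling.typDelta ε P) (GuessingCoupling.typDelta ε Q))
            ((1 - ε) * GuessingCoupling.shannonEntropy Q
              - (1 + ε) * GuessingCoupling.shannonEntropy P) : ℝ) : EReal))
        ≤ GuessingCoupling.expRate (fun n : ℕ => GuessingCoupling.maxGuessProb
            (GuessingCoupling.prodDist P n) (GuessingCoupling.prodDist Q n))) ∧
    (GuessingCoupling.shannonEntropy P = GuessingCoupling.shannonEntropy Q →
      ∀ n : ℕ, GuessingCoupling.maxGuessProb P Q ^ n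
        ≤ GuessingCoupling.maxGuessProb
            (GuessingCoupling.prodDist P n) (GuessingCoupling.prodDist Q n)) := by
  classical
  have hPn := fun n => prodDist_mem_stdSimplex hP n
  have hQn := fun n => prodDist_mem_stdSimplex hQ n
  refine ⟨fun hlt => ?_, fun hlt => ?_, fun _ => pow_maxGuessProb_le hP hQ⟩
  · obtain ⟨t, ht, hmax⟩ := exists_isMaxOn_renyi hP hQ
    obtain ⟨M, hM⟩ : ∃ M, t * (renyiEntropy (1 + t) P - renyiEntropy (1 - t) Q) = M := ⟨_, rfl⟩
    have hM0 : 0 < M := by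
      obtain ⟨t', ht', hpos⟩ := exists_renyi_pos hP hQ hlt
      exact hM ▸ hpos.trans_le (hmax ht')
    have hbound := one_sub_maxGuessProb_prodDist_le hP hQ ht hM hM0.le
    have hnonneg : ∀ n, 0 ≤ 1 - maxGuessProb (prodDist P n) (prodDist Q n) := fun n =>
      sub_nonneg.2 (maxGuessProb_le_one (hPn n) (hQn n))
    refine ⟨?_, ⟨1 / 2 * M, by positivity, 2, two_pos, fun n => ?_⟩, M, ⟨⟨t, ht, hM⟩, ?_⟩, ?_⟩
    · have := (tendsto_zero_of_le_exp (by positivity) hnonneg hbound).const_sub 1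
      simpa using this
    · exact (abs_of_nonneg (hnonneg n)).trans_le (hbound n)
    · rintro _ ⟨t', ht', rfl⟩
      exact hM ▸ hmax ht'
    · exact coe_le_expRate two_pos hbound
  · have hC : (0 : ℝ) < Fintype.card X + Fintype.card Y + 1 := by positivity
    have hnonneg : ∀ n, 0 ≤ maxGuessProb (prodDist P n) (prodDist Q n) := fun n =>
      maxGuessProb_nonneg (hPn n) (hQn n)
    have hcard : 0 < (Fintype.card Y : ℝ) := by
      rw [Nat.cast_pos, Fintype.card_pos_iff]
      by_contra h
      rw [not_nonempty_iff] at h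
      simpa using hQ.2
    have hlower : ∀ n : ℕ, 1 * Real.exp (-Real.log (Fintype.card Y) * n)
        ≤ maxGuessProb (prodDist P n) (prodDist Q n) := by
      intro n
      rw [one_mul, mul_comm, Real.exp_nat_mul, Real.exp_neg, Real.exp_log hcard]
      exact (pow_le_pow_left₀ (by positivity) (inv_card_le_maxGuessProb hP hQ) n).trans
        (pow_maxGuessProb_le hP hQ n)
    obtain ⟨ε, hε, hpos⟩ : ∃ ε ∈ Set.Ioo (0 : ℝ) 1,
        0 < (1 - ε) * shannonEntropy Q - (1 + ε) * shannonEntropy P := by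
      have hcont : Tendsto
          (fun ε : ℝ => (1 - ε) * shannonEntropy Q - (1 + ε) * shannonEntropy P) (𝓝[>] 0)
          (𝓝 ((1 - 0) * shannonEntropy Q - (1 + 0) * shannonEntropy P)) :=
        (Continuous.tendsto (by fun_prop) 0).mono_left nhdsWithin_le_nhds
      obtain ⟨ε, h, hε⟩ := ((hcont.eventually_const_lt (u := 0) (by linarith)).and
        (Ioo_mem_nhdsGT (show (0 : ℝ) < 1 by norm_num))).exists
      exact ⟨ε, hε, h⟩
    have hrate := lt_min (lt_min (typDelta_pos hP hε.1) (typDelta_pos hQ hε.1)) hpos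
    have hupper := maxGuessProb_prodDist_le hP hQ hε
    refine ⟨tendsto_zero_of_le_exp hrate hnonneg hupper,
      ⟨⟨_, hrate, _, hC, fun n => (abs_of_nonneg (hnonneg n)).trans_le (hupper n)⟩,
        Real.log (Fintype.card Y) + 1,
        add_pos_of_nonneg_of_pos (Real.log_natCast_nonneg _) one_pos, 1, one_pos, fun n => ?_⟩,
      expRate_le_coe one_pos hlower,
      iSup₂_le fun ε hε => coe_le_expRate hC (maxGuessProb_prodDist_le hP hQ hε)⟩
    -- The exponent `log |Y| + 1` is used because a rate must be positive by definition.
    rw [abs_of_nonneg (hnonneg n)]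
    refine le_trans ?_ (hlower n)
    gcongr
    linarith
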